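/- Let $[\mathbb{N}]^{\mathbb{N}}$ be the space of strictly increasing functions $f:\mathbb{N}\to\mathbb{N}$ with the topology induced by Baire space $\mathbb{N}^{\mathbb{N}}$; points of both spaces are their own names. A name of an open set is an enumeration of finite strings whose cones have that set as their union; a name of a closed set is a name of its complement. For $P\subseteq[\mathbb{N}]^{\mathbb{N}}$ let \[ \mathrm{HS}(P):=\{f\in[\mathbb{N}]^{\mathbb{N}} : (\forall g\in[\mathbb{N}]^{\mathbb{N}})(f\circ g\in P)\ \lor\ (\forall g\in[\mathbb{N}]^{\mathbb{N}})(f\circ g\notin P)\}. \] Consider the following multivalued functions between represented spaces: - $\mathsf{C}_{\mathbb{N}^{\mathbb{N}}}$: given a nonempty closed set $A\subseteq\mathbb{N}^{\mathbb{N}}$, find an element of $A$; - $\Sigma^0_1\text{-}\mathsf{RT}$: given an open set $P\subseteq[\mathbb{N}]^{\mathbb{N}}$, find an element of $\mathrm{HS}(P)$; - $\mathsf{FindHS}_{\Sigma^0_1}$: given an open set $P\subseteq[\mathbb{N}]^{\mathbb{N}}$ with $\mathrm{HS}(P)\cap P\neq\emptyset$, find an element of $\mathrm{HS}(P)\cap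 P$. Let $\le_{\mathrm{W}}$ denote Weihrauch reducibility: $f\le_{\mathrm{W}} g$ iff there are computable $\Phi,\Psi:\subseteq\mathbb{N}^{\mathbb{N}}\to\mathbb{N}^{\mathbb{N}}$ such that $p\mapsto\Psi(\langle p,G\Phi(p)\rangle)$ is a realizer of $f$ for every realizer $G$ of $g$. Let $f*g$ denote the compositional product, i.e. the Weihrauch degree $\max_{\le_{\mathrm{W}}}\{f_0\circ g_0 : f_0\le_{\mathrm{W}} f,\ g_0\le_{\mathrm{W}} g\}$. Then the compositional product $\mathsf{C}_{\mathbb{N}^{\mathbb{N}}}*\Sigma^0_1\text{-}\mathsf{RT}$ exists and \[ \mathsf{C}_{\mathbb{N}^{\mathbb{N}}}*\Sigma^0_1\text{-}\mathsf{RT}\ \le_{\mathrm{W}}\ \mathsf{FindHS}_{\Sigma^0_1}. \] In particular $\Sigma^0_1\text{-}\mathsf{RT}\le_{\mathrm{W}}\mathsf{FindHS}_{\Sigma^0_1}$. -/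

import Mathlib

universe u v w z

namespace Weihrauch

open TopologicalSpace

/-- Baire space `ℕ^ℕ` with the product topology. -/
abbrev Baire : Type := ℕ → ℕ

/-- The prefix `p[n] = ⟨p 0, …, p (n-1)⟩`. -/
def pre (p : Baire) (n : ℕ) : List ℕ := (List.range n).map p

/-- `σ ⊏ p`: the finite string `σ` is a prefix of `p`. -/
def IsPre (σ : List ℕ) (p : Baire) : Prop := pre p σ.length = σ

/-- A partial map `F :⊆ ℕ^ℕ → ℕ^ℕ` is computable if some monotone computable map `φ` on finite
strings satisfies `F p = ⋃ₖ φ (p[k])` for all `p ∈ dom F`. -/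
def ComputableMap (F : Baire →. Baire) : Prop :=
  ∃ φ : List ℕ → List ℕ, Computable φ ∧ (∀ σ τ : List ℕ, σ <+: τ → φ σ <+: φ τ) ∧
    ∀ p : Baire, ∀ q ∈ F p,
      (∀ k, IsPre (φ (pre p k)) q) ∧ (∀ n, ∃ k, n ≤ (φ (pre p k)).length)

/-- The pairing `⟨p, q⟩ = (p 0, q 0, p 1, q 1, …)` on Baire space. -/
def pair (p q : Baire) : Baire := fun n => if n % 2 = 0 then p (n / 2) else q (n / 2)

/-- A represented space: a set `X` with a partial surjection `δ :⊆ ℕ^ℕ → X`. -/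
class RepresentedSpace (X : Type u) where
  δ : Baire →. X
  surj : ∀ x : X, ∃ p : Baire, x ∈ δ p

/-- Partial multivalued functions `f :⊆ X ⇉ Y`; the domain is `{x | f x ≠ ∅}`. -/
abbrev MultiFun (X : Type u) (Y : Type v) : Type (max u v) := X → Set Y

/-- The domain of a partial multivalued function. -/
def MultiFun.dom {X : Type u} {Y : Type v} (f : MultiFun X Y) : Set X := {x | (f x).Nonempty}

/-- Composition of partial multivalued functions, with
`dom (f ∘ g) = {x ∈ dom g | g x ⊆ dom f}` and `(f ∘ g) x = ⋃ {f y | y ∈ g x}`. -/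
def MultiFun.comp {X : Type u} {Y : Type v} {Z : Type w}
    (f : MultiFun Y Z) (g : MultiFun X Y) : MultiFun X Z :=
  fun x => {c | g x ⊆ f.dom ∧ ∃ y ∈ g x, c ∈ f y}

/-- `F ⊢ f`: for every name `p` of a point `x ∈ dom f`, `F p` is defined and is a name of an
element of `f x`. -/
def IsRealizer {X : Type u} {Y : Type v} [RepresentedSpace X] [RepresentedSpace Y]
    (F : Baire →. Baire) (f : MultiFun X Y) : Prop :=
  ∀ p : Baire, ∀ x ∈ RepresentedSpace.δ (X := X) p, x ∈ f.dom →
    ∃ q ∈ F p, ∃ y ∈ RepresentedSpace.δ (X := Y) q, y ∈ f x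

/-- Weihrauch reducibility `f ≤_W g`: there are computable `Φ, Ψ :⊆ ℕ^ℕ → ℕ^ℕ` such that
`p ↦ Ψ ⟨p, G (Φ p)⟩` realizes `f` for every realizer `G` of `g`. -/
def WReducible {X : Type u} {Y : Type v} {Z : Type w} {W : Type z}
    [RepresentedSpace X] [RepresentedSpace Y] [RepresentedSpace Z] [RepresentedSpace W]
    (f : MultiFun X Y) (g : MultiFun Z W) : Prop :=
  ∃ Φ Ψ : Baire →. Baire, ComputableMap Φ ∧ ComputableMap Ψ ∧
    ∀ G : Baire →. Baire, IsRealizer G g →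
      IsRealizer (fun p => (Φ p).bind fun a => (G a).bind fun b => Ψ (pair p b)) f

/-- `h` represents the compositional product `f * g`, i.e. its Weihrauch degree is the maximum
with respect to `≤_W` of all `f₀ ∘ g₀` with `f₀ ≤_W f` and `g₀ ≤_W g`: the degree is attained by
such a composition, and `h` is above every such composition (through represented spaces in
arbitrary universes). -/
def IsCompositionalProduct {X Y X₁ Y₁ X₂ Y₂ : Type}
    [RepresentedSpace X] [RepresentedSpace Y] [RepresentedSpace X₁] [RepresentedSpace Y₁]
    [RepresentedSpace X₂] [RepresentedSpace Y₂]
    (h : MultiFun X Y) (f : MultiFun X₁ Y₁) (g : MultiFun X₂ Y₂) : Prop :=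
  (∃ (A B C : Type) (_ : RepresentedSpace A) (_ : RepresentedSpace B) (_ : RepresentedSpace C)
      (f₀ : MultiFun B C) (g₀ : MultiFun A B),
      WReducible f₀ f ∧ WReducible g₀ g ∧
        WReducible h (f₀.comp g₀) ∧ WReducible (f₀.comp g₀) h) ∧
  (∀ (A : Type u) (B : Type v) (C : Type w)
      [RepresentedSpace A] [RepresentedSpace B] [RepresentedSpace C]
      (f₀ : MultiFun B C) (g₀ : MultiFun A B),
      WReducible f₀ f → WReducible g₀ g → WReducible (f₀.comp g₀) h)

/-- The Ramsey space `[ℕ]^ℕ` of strictly increasing sequences, with the subspace topology. -/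
abbrev Ramsey : Type := {f : Baire // StrictMono f}

/-- The composition `fg`; the sequences `fg` with `g ∈ [ℕ]^ℕ` are the subsequences of `f`. -/
def Ramsey.comp (f g : Ramsey) : Ramsey := ⟨f.1 ∘ g.1, f.2.comp g.2⟩

/-- The open subset of Baire space with name `p`: the union of the cylinders of all strings
enumerated by `p`. The value `p i` codes an element of `Option (List ℕ)`: `0` enumerates nothing
and `code σ + 1` enumerates the string `σ`. -/
def enumOpen (p : Baire) : Set Baire :=
  {f | ∃ i : ℕ, ∃ σ : List ℕ, Denumerable.ofNat (Option (List ℕ)) (p i) = some σ ∧ IsPre σ f}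

theorem isPre_iff (σ : List ℕ) (f : Baire) :
    IsPre σ f ↔ ∀ i (h : i < σ.length), f i = σ[i] := by
  unfold IsPre pre
  constructor
  · intro h i hi
    have := List.getElem_of_eq h (i := i) (by simpa using hi)
    simpa using this
  · intro h
    apply List.ext_getElem
    · simp
    · intro i h1 h2
      simpa using h i h2

theorem isOpen_cylinder (σ : List ℕ) : IsOpen {f : Baire | IsPre σ f} := by
  have : {f : Baire | IsPre σ f} = ⋂ i : Fin σ.length, {f : Baire | f i = σ[i]} := by
    ext f
    simp only [Set.mem_ofPred_eq, isPre_iff, Set.mem_iInter]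
    exact ⟨fun h i => h i i.2, fun h i hi => h ⟨i, hi⟩⟩
  rw [this]
  refine isOpen_iInter_of_finite fun i => ?_
  have hc : Continuous fun f : Baire => f i := continuous_apply (i : ℕ)
  exact (isOpen_discrete ({σ[i]} : Set ℕ)).preimage hc

theorem isOpen_enumOpen (p : Baire) : IsOpen (enumOpen p) := by
  have : enumOpen p = ⋃ i : ℕ, ⋃ σ : List ℕ,
      ⋃ _ : Denumerable.ofNat (Option (List ℕ)) (p i) = some σ, {f : Baire | IsPre σ f} := by
    ext f
    simp [enumOpen]
  rw [this]
  exact isOpen_iUnion fun _ => isOpen_iUnion fun σ => isOpen_iUnion fun _ => isOpen_cylinder σ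

theorem exists_cylinder_subset {V : Set Baire} (hV : IsOpen V) {f : Baire} (hf : f ∈ V) :
    ∃ n, {g : Baire | IsPre (pre f n) g} ⊆ V := by
  obtain ⟨I, t, ht, hI⟩ := isOpen_pi_iff.1 hV f hf
  refine ⟨I.sup id + 1, fun g hg => hI ?_⟩
  intro i hi
  have hlt : i < I.sup id + 1 := Nat.lt_succ_of_le (Finset.le_sup (f := id) hi)
  have := (isPre_iff _ _).1 hg i (by simpa [pre] using hlt)
  have e : g i = f i := by simpa [pre] using this
  rw [e]
  exact (ht i hi).2

/-- Every open subset of Baire space has a name. -/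
theorem exists_enumOpen_eq {V : Set Baire} (hV : IsOpen V) : ∃ p, enumOpen p = V := by
  classical
  refine ⟨fun i => if ∃ σ, Denumerable.ofNat (Option (List ℕ)) i = some σ ∧
    {g : Baire | IsPre σ g} ⊆ V then i else Encodable.encode (none : Option (List ℕ)), ?_⟩
  ext f
  constructor
  · rintro ⟨i, σ, h, hσ⟩
    dsimp only at h
    split_ifs at h with hc
    · obtain ⟨τ, h1, h2⟩ := hc
      rw [h] at h1
      cases h1
      exact h2 hσ
    · rw [Denumerable.ofNat_encode] at h
      cases h
  · intro hf
    obtain ⟨n, hn⟩ := exists_cylinder_subset hV hf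
    refine ⟨Encodable.encode (some (pre f n)), pre f n, ?_, ?_⟩
    · beta_reduce
      rw [if_pos ⟨pre f n, Denumerable.ofNat_encode _, hn⟩, Denumerable.ofNat_encode]
    · rw [isPre_iff]
      intro i hi
      simp [pre]

/-- Baire space is represented by the identity. -/
instance : RepresentedSpace Baire where
  δ := fun p => Part.some p
  surj := fun x => ⟨x, Part.mem_some x⟩

/-- The Ramsey space is represented by the restriction of the identity. -/
instance : RepresentedSpace Ramsey where
  δ := fun p => ⟨StrictMono p, fun h => ⟨p, h⟩⟩
  surj := fun x => ⟨x.1, x.2, rfl⟩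

/-- The represented space `Π⁰₁(ℕ^ℕ)`: a name of a closed set is a name of its complement. -/
instance : RepresentedSpace (Closeds Baire) where
  δ := fun p => Part.some ⟨(enumOpen p)ᶜ, (isOpen_enumOpen p).isClosed_compl⟩
  surj := fun A => by
    obtain ⟨p, hp⟩ := exists_enumOpen_eq A.isClosed.isOpen_compl
    refine ⟨p, ?_⟩
    rw [Part.mem_some_iff]
    ext x
    simp [hp]

/-- The represented space `Σ⁰₁([ℕ]^ℕ)`: `p` names the set of all strictly increasing `f` that
extend some string enumerated by `p`. -/
instance : RepresentedSpace (Opens Ramsey) where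
  δ := fun p => Part.some
    ⟨{f : Ramsey | f.1 ∈ enumOpen p}, (isOpen_enumOpen p).preimage continuous_subtype_val⟩
  surj := fun U => by
    obtain ⟨V, hV, hU⟩ := isOpen_induced_iff.1 U.isOpen
    obtain ⟨p, hp⟩ := exists_enumOpen_eq hV
    refine ⟨p, ?_⟩
    rw [Part.mem_some_iff]
    ext x
    change x ∈ (U : Set Ramsey) ↔ x.1 ∈ enumOpen p
    rw [hp, ← hU]
    rfl

/-- Closed choice `C_{ℕ^ℕ}`: given a nonempty closed set, find an element of it. -/
def closedChoice : MultiFun (Closeds Baire) Baire := fun A => {x | x ∈ A}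

/-- The set `HS(P)` of homogeneous solutions of `P`. -/
def HS (P : Set Ramsey) : Set Ramsey :=
  {f | (∀ g : Ramsey, f.comp g ∈ P) ∨ (∀ g : Ramsey, f.comp g ∉ P)}

/-- The full version `Σ⁰₁-RT` of the open Ramsey theorem. -/
def openRT : MultiFun (Opens Ramsey) Ramsey := fun P => HS P

/-- The strong open Ramsey problem `FindHS_{Σ⁰₁}`: given an open set `P` with
`HS(P) ∩ P ≠ ∅`, find an element of `HS(P) ∩ P`. -/
def findHSOpen : MultiFun (Opens Ramsey) Ramsey := fun P => HS P ∩ P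

end Weihrauch

/-!
The compositional product is represented by the following problem on Baire space: given
`⟨r, b⟩`, find `⟨f, x⟩` outside the open set named by `r` such that `f` is homogeneous for the open
set `P` named by `b`. This is the composition `sectionChoice.comp paramOpenRT`. It is the maximum
(`comp_reducible`) because, if the closed set `A_f` is computed from a parameter `p` and from `f`,
then the set of all `⟨f, x⟩` with `x ∉ A_f` is open with a name `r` computable from `p`. No universal
machine is involved: the name `r` stands for the functional.

To reduce this problem to finding a homogeneous element inside an open set `Q`, let the elements of
`[ℕ]^ℕ` list codes of strings `s₀, s₁, …`, meant to be longer and longer prefixes of a tag followed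
by `⟨f, x⟩`. If all subsequences of such a sequence are in `Q`, every clopen condition on two
consecutive strings holds for all pairs. In this way `Q` enforces that the strings form a chain and
that their limit satisfies all closed conditions: `⟨f, x⟩` is outside the set named by `r`, `f` is
strictly increasing and, if the tag is `0`, no subsequence of `f` is in `P`. That all subsequences
of `f` are in `P` is a `Π¹₁` condition. For the other tags it is enforced by letting `Q` contain the
sequence only if all increasing selections of a `j`-th term from the part of `f` in `s_j` are in `P`.
By compactness this is an open condition (`exists_uniform_stage`), and since it holds for all
subsequences of `s₀, s₁, …`, along which the strings grow arbitrarily fast, it covers every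
subsequence of `f`. The two directions are `exists_accepted` and `decodeSolution_spec`.

Weihrauch reducibility is used through a criterion without realizers (`WReducible.of_forall`,
`WReducible.exists_forall`). That homogeneous elements exist is part of the assumption that an
instance is in the domain, so the open Ramsey theorem itself is not needed.
-/

namespace Weihrauch

open TopologicalSpace

/-! ### Finite prefixes -/

@[simp] theorem length_pre (p : Baire) (n : ℕ) : (pre p n).length = n := by simp [pre]

@[simp] theorem getElem_pre (p : Baire) (n i : ℕ) (h : i < (pre p n).length) :
    (pre p n)[i] = p i := by simp [pre]

theorem getD_pre (p : Baire) {n i : ℕ} (h : i < n) : (pre p n).getD i 0 = p i := by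
  simp [pre, List.getD_eq_getElem?_getD, h]

theorem mem_pre {p : Baire} {n a : ℕ} : a ∈ pre p n ↔ ∃ i < n, p i = a := by simp [pre]

theorem map_range_eq_pre {p : Baire} {n : ℕ} {f : ℕ → ℕ} (h : ∀ i < n, f i = p i) :
    (List.range n).map f = pre p n :=
  List.map_congr_left fun i hi => h i (List.mem_range.1 hi)

theorem take_pre (p : Baire) {m n : ℕ} (h : m ≤ n) : (pre p n).take m = pre p m := by
  simp [pre, ← List.map_take, List.take_range, h]

theorem pre_prefix_pre (p : Baire) {m n : ℕ} (h : m ≤ n) : pre p m <+: pre p n := by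
  rw [← take_pre p h]; exact List.take_prefix _ _

theorem isPre_pre (p : Baire) (n : ℕ) : IsPre (pre p n) p := by simp [IsPre]

theorem IsPre.prefix_pre {σ : List ℕ} {p : Baire} (h : IsPre σ p) {n : ℕ} (hn : σ.length ≤ n) :
    σ <+: pre p n := by
  have := pre_prefix_pre p hn
  rwa [h] at this

theorem IsPre.of_prefix {σ τ : List ℕ} {p : Baire} (h : IsPre τ p) (hσ : σ <+: τ) : IsPre σ p := by
  rw [IsPre, ← take_pre p hσ.length_le, h, ← List.prefix_iff_eq_take.1 hσ]

theorem isPre_of_prefix_pre {σ : List ℕ} {p : Baire} {n : ℕ} (h : σ <+: pre p n) : IsPre σ p :=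
  (isPre_pre p n).of_prefix h

/-- The even-indexed half of a point of Baire space, the first component of a `pair`. -/
def pairFst (p : Baire) : Baire := fun n => p (2 * n)

/-- The odd-indexed half of a point of Baire space, the second component of a `pair`. -/
def pairSnd (p : Baire) : Baire := fun n => p (2 * n + 1)

@[simp] theorem pairFst_pair (p q : Baire) : pairFst (pair p q) = p := by
  funext n; simp [pairFst, pair]

@[simp] theorem pairSnd_pair (p q : Baire) : pairSnd (pair p q) = q := by
  funext n
  have : (2 * n + 1) / 2 = n := by omega
  simp [pairSnd, pair, Nat.add_mod, this]

@[simp] theorem pair_pairFst_pairSnd (p : Baire) : pair (pairFst p) (pairSnd p) = p := by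
  funext n
  simp only [pair, pairFst, pairSnd]
  split_ifs <;> congr 1 <;> omega

/-- The even-indexed entries of a string, up to half its length. -/
def evens (l : List ℕ) : List ℕ := (List.range (l.length / 2)).map fun i => l.getD (2 * i) 0

/-- The odd-indexed entries of a string. -/
def odds (l : List ℕ) : List ℕ := (List.range (l.length / 2)).map fun i => l.getD (2 * i + 1) 0

theorem evens_pre (p : Baire) (n : ℕ) : evens (pre p n) = pre (pairFst p) (n / 2) := by
  rw [evens, length_pre]
  refine map_range_eq_pre fun i hi => ?_
  rw [getD_pre _ (by omega), pairFst]

theorem odds_pre (p : Baire) (n : ℕ) : odds (pre p n) = pre (pairSnd p) (n / 2) := by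
  rw [odds, length_pre]
  refine map_range_eq_pre fun i hi => ?_
  rw [getD_pre _ (by omega), pairSnd]

/-- The finite version of `pair`, cut off where one of the two strings ends. -/
def interleave (l m : List ℕ) : List ℕ :=
  (List.range (2 * min l.length m.length)).map fun n =>
    if n % 2 = 0 then l.getD (n / 2) 0 else m.getD (n / 2) 0

theorem interleave_pre (p q : Baire) (m n : ℕ) :
    interleave (pre p m) (pre q n) = pre (pair p q) (2 * min m n) := by
  rw [interleave, length_pre, length_pre]
  refine map_range_eq_pre fun i hi => ?_
  rw [getD_pre _ (by omega), getD_pre _ (by omega), pair]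

theorem interleave_prefix {l l' m m' : List ℕ} (hl : l <+: l') (hm : m <+: m') :
    interleave l m <+: interleave l' m' := by
  have h1 := hl.length_le
  have h2 := hm.length_le
  have key : ∀ {l l' : List ℕ}, l <+: l' → ∀ i < l.length, l.getD i 0 = l'.getD i 0 := by
    rintro l _ ⟨t, rfl⟩ i hi
    rw [List.getD_append _ _ _ _ hi]
  have e : interleave l m = (interleave l' m').take (2 * min l.length m.length) := by
    rw [interleave, interleave, ← List.map_take, List.take_range,
      min_eq_left (show 2 * min l.length m.length ≤ 2 * min l'.length m'.length by omega)]
    refine List.map_congr_left fun i hi => ?_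
    rw [List.mem_range] at hi
    rw [key hl _ (by omega), key hm _ (by omega)]
  rw [e]
  exact List.take_prefix _ _

/-- The strings enumerated by the entries of a finite piece of a name of an open set. -/
def strings (l : List ℕ) : List (List ℕ) :=
  l.flatMap fun a => (Denumerable.ofNat (Option (List ℕ)) a).toList

theorem mem_strings {l : List ℕ} {σ : List ℕ} :
    σ ∈ strings l ↔ ∃ a ∈ l, Denumerable.ofNat (Option (List ℕ)) a = some σ := by
  simp [strings]

theorem mem_strings_pre {p : Baire} {n : ℕ} {σ : List ℕ} :
    σ ∈ strings (pre p n) ↔ ∃ i < n, Denumerable.ofNat (Option (List ℕ)) (p i) = some σ := by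
  simp [mem_strings, pre]

theorem strings_pre_mono (p : Baire) {m n : ℕ} (h : m ≤ n) {σ : List ℕ}
    (hσ : σ ∈ strings (pre p m)) : σ ∈ strings (pre p n) := by
  rw [mem_strings_pre] at *
  obtain ⟨i, hi, e⟩ := hσ
  exact ⟨i, hi.trans_le h, e⟩

theorem mem_enumOpen {p f : Baire} :
    f ∈ enumOpen p ↔ ∃ n, ∃ σ ∈ strings (pre p n), IsPre σ f := by
  simp only [mem_strings_pre]
  constructor
  · rintro ⟨i, σ, h, hσ⟩
    exact ⟨i + 1, σ, ⟨i, by omega, h⟩, hσ⟩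
  · rintro ⟨n, σ, ⟨i, _, h⟩, hσ⟩
    exact ⟨i, σ, h, hσ⟩

/-! ### Computability of operations on strings -/

section Primrec

open Primrec

theorem primrec_evens : Primrec evens :=
  list_map (list_range.comp (nat_div.comp list_length (const 2)))
    ((list_getD 0).comp fst (nat_mul.comp (const 2) snd)).to₂

theorem primrec_odds : Primrec odds :=
  list_map (list_range.comp (nat_div.comp list_length (const 2)))
    ((list_getD 0).comp fst (nat_add.comp (nat_mul.comp (const 2) snd) (const 1))).to₂

theorem primrec_interleave : Primrec₂ interleave := by
  refine list_map (f := fun x : List ℕ × List ℕ => List.range (2 * min x.1.length x.2.length))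
    (g := fun x n => if n % 2 = 0 then x.1.getD (n / 2) 0 else x.2.getD (n / 2) 0) ?_ ?_
  · exact list_range.comp (nat_mul.comp (const 2)
      (nat_min.comp (list_length.comp fst) (list_length.comp snd)))
  · have hn : Primrec fun x : (List ℕ × List ℕ) × ℕ => x.2 / 2 := nat_div.comp snd (const 2)
    exact Primrec.ite (Primrec.eq.comp (nat_mod.comp snd (const 2)) (const 0))
      ((list_getD 0).comp (fst.comp fst) hn) ((list_getD 0).comp (snd.comp fst) hn)

theorem primrec_strings : Primrec strings := by
  refine list_flatMap Primrec.id ?_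
  have : Primrec fun o : Option (List ℕ) => o.toList :=
    (option_casesOn (f := fun _ : Option (List ℕ) => ([] : List (List ℕ)))
      (g := fun _ a => [a]) Primrec.id (const [])
      (list_cons.comp snd (const [])).to₂).of_eq fun o => by cases o <;> rfl
  exact (this.comp ((Primrec.ofNat (Option (List ℕ))).comp snd)).to₂

theorem primrecRel_prefix : PrimrecRel fun l m : List ℕ => l <+: m :=
  (Primrec.eq.comp fst (list_take.comp (list_length.comp fst) snd)).of_eq fun _ =>
    List.prefix_iff_eq_take.symm

theorem primrecRel_mem : PrimrecRel fun (a : ℕ) (l : List ℕ) => a ∈ l :=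
  ((PrimrecRel.exists_mem_list Primrec.eq).comp snd fst).of_eq fun x => by simp

theorem primrecRel_subset : PrimrecRel fun l m : List ℕ => ∀ a ∈ l, a ∈ m :=
  PrimrecRel.forall_mem_list primrecRel_mem

theorem primrecPred_sorted : PrimrecPred fun l : List ℕ => l.Pairwise (· < ·) := by
  have h1 : PrimrecRel fun (i : ℕ) (x : ℕ × List ℕ) => x.2.getD i 0 < x.2.getD x.1 0 :=
    nat_lt.comp ((list_getD 0).comp (snd.comp snd) fst)
      ((list_getD 0).comp (snd.comp snd) (fst.comp snd))
  have h2 : PrimrecRel fun (j : ℕ) (l : List ℕ) =>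
      ∀ i ∈ List.range j, l.getD i 0 < l.getD j 0 :=
    h1.forall_mem_list.comp (list_range.comp fst) Primrec.id
  refine (h2.forall_mem_list.comp (list_range.comp list_length) Primrec.id).of_eq fun l => ?_
  simp only [List.mem_range, id]
  rw [List.pairwise_iff_getElem]
  constructor
  · intro h i j hi hj hij
    have := h j hj i hij
    simpa [List.getD_eq_getElem?_getD, hi, hj] using this
  · intro h j hj i hij
    have := h i j (hij.trans hj) hj hij
    simpa [List.getD_eq_getElem?_getD, hij.trans hj, hj] using this

theorem primrec_sections : Primrec (List.sections : List (List ℕ) → List (List ℕ)) := by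
  have h : Primrec₂ fun (_ : List (List ℕ)) (x : List ℕ × List (List ℕ)) =>
      x.2.flatMap fun s => x.1.map fun a => a :: s := by
    refine list_flatMap (f := fun y : List (List ℕ) × (List ℕ × List (List ℕ)) => y.2.2)
      (snd.comp snd) ?_
    exact list_map (f := fun y : (List (List ℕ) × (List ℕ × List (List ℕ))) × List ℕ => y.1.2.1)
      (fst.comp (snd.comp fst)) (list_cons.comp snd (snd.comp fst)).to₂
  refine (list_foldr Primrec.id (const [[]]) h).of_eq fun L => ?_
  induction L with
  | nil => rfl
  | cons l L ih => simp only [id, List.foldr_cons, List.sections] at *; rw [ih]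

end Primrec

theorem computable_map_range {α : Type*} [Primcodable α] {n : α → ℕ} {f : α → ℕ → ℕ}
    (hn : Computable n) (hf : Computable₂ f) :
    Computable fun a => (List.range (n a)).map (f a) := by
  have := Computable.nat_rec (h := fun a (x : ℕ × List ℕ) => x.2 ++ [f a x.1]) hn
    (Computable.const ([] : List ℕ))
    (Computable.list_concat.comp (Computable.snd.comp Computable.snd)
      (hf.comp Computable.fst (Computable.fst.comp Computable.snd))).to₂
  refine this.of_eq fun a => ?_
  induction n a with
  | zero => rfl
  | succ k ih => simp only [List.range_succ, List.map_append, List.map_singleton, ← ih]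

/-! ### Computable maps on Baire space -/

/-- A total map each of whose values depends computably on a linearly bounded prefix of the
argument is computable. -/
theorem computableMap_of_linear_use {f : Baire → Baire} (C : ℕ) (hC : 0 < C)
    {c : List ℕ → ℕ → ℕ} (hc : Computable₂ c) (hf : ∀ p n, f p n = c (pre p (C * (n + 1))) n) :
    ComputableMap fun p => Part.some (f p) := by
  refine ⟨fun σ => (List.range (σ.length / C)).map fun n => c (σ.take (C * (n + 1))) n, ?_, ?_, ?_⟩
  · refine computable_map_range
      (Primrec.nat_div.comp Primrec.list_length (Primrec.const C)).to_comp ?_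
    refine hc.comp (f := c) ?_ Computable.snd
    exact (Primrec.list_take.comp (Primrec.nat_mul.comp (Primrec.const C)
      (Primrec.succ.comp Primrec.snd)) Primrec.fst).to_comp
  · rintro σ _ ⟨t, rfl⟩
    have hle : σ.length / C ≤ (σ ++ t).length / C := Nat.div_le_div_right (by simp)
    have e : ((List.range (σ.length / C)).map fun n => c (σ.take (C * (n + 1))) n) =
        ((List.range ((σ ++ t).length / C)).map fun n => c ((σ ++ t).take (C * (n + 1))) n).take
          (σ.length / C) := by
      rw [← List.map_take, List.take_range, min_eq_left hle]
      refine List.map_congr_left fun i hi => ?_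
      rw [List.mem_range] at hi
      rw [List.take_append_of_le_length]
      calc C * (i + 1) ≤ C * (σ.length / C) := Nat.mul_le_mul_left _ hi
        _ ≤ σ.length := Nat.mul_div_le _ _
    beta_reduce
    rw [e]
    exact List.take_prefix _ _
  · intro p q hq
    rw [Part.mem_some_iff] at hq
    subst hq
    have e : ∀ k, ((List.range ((pre p k).length / C)).map fun n =>
        c ((pre p k).take (C * (n + 1))) n) = pre (f p) (k / C) := by
      intro k
      rw [length_pre]
      refine map_range_eq_pre fun i hi => ?_
      rw [hf, take_pre]
      calc C * (i + 1) ≤ C * (k / C) := Nat.mul_le_mul_left _ hi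
        _ ≤ k := Nat.mul_div_le _ _
    refine ⟨fun k => ?_, fun n => ⟨C * n, ?_⟩⟩
    · beta_reduce
      rw [e]
      exact isPre_pre _ _
    · beta_reduce
      rw [e, length_pre, Nat.mul_div_cancel_left _ hC]

theorem ComputableMap.bind {F G : Baire →. Baire} (hF : ComputableMap F) (hG : ComputableMap G) :
    ComputableMap fun p => (F p).bind G := by
  obtain ⟨φ, hφ, mφ, cφ⟩ := hF
  obtain ⟨ψ, hψ, mψ, cψ⟩ := hG
  refine ⟨fun σ => ψ (φ σ), hψ.comp hφ, fun σ τ h => mψ _ _ (mφ _ _ h), ?_⟩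
  intro p r hr
  obtain ⟨q, hq, hr⟩ := Part.mem_bind_iff.1 hr
  obtain ⟨h1, h2⟩ := cφ p q hq
  obtain ⟨h3, h4⟩ := cψ q r hr
  have e : ∀ k, φ (pre p k) = pre q (φ (pre p k)).length := fun k => (h1 k).symm
  refine ⟨fun k => ?_, fun n => ?_⟩
  · beta_reduce
    rw [e]
    exact h3 _
  · obtain ⟨l, hl⟩ := h4 n
    obtain ⟨k, hk⟩ := h2 l
    refine ⟨k, hl.trans (mψ _ _ ?_).length_le⟩
    rw [e]
    exact pre_prefix_pre _ hk

theorem ComputableMap.pair {F G : Baire →. Baire} (hF : ComputableMap F) (hG : ComputableMap G) :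
    ComputableMap fun p => (F p).bind fun a => (G p).map fun b => Weihrauch.pair a b := by
  obtain ⟨φ, hφ, mφ, cφ⟩ := hF
  obtain ⟨ψ, hψ, mψ, cψ⟩ := hG
  refine ⟨fun σ => interleave (φ σ) (ψ σ), primrec_interleave.to_comp.comp hφ hψ,
    fun σ τ h => interleave_prefix (mφ _ _ h) (mψ _ _ h), ?_⟩
  intro p r hr
  obtain ⟨a, ha, hr⟩ := Part.mem_bind_iff.1 hr
  obtain ⟨b, hb, rfl⟩ := (Part.mem_map_iff _).1 hr
  obtain ⟨h1, h2⟩ := cφ p a ha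
  obtain ⟨h3, h4⟩ := cψ p b hb
  have e : ∀ k, interleave (φ (pre p k)) (ψ (pre p k)) =
      pre (Weihrauch.pair a b) (2 * min (φ (pre p k)).length (ψ (pre p k)).length) := by
    intro k
    rw [← interleave_pre, h1 k, h3 k]
  refine ⟨fun k => ?_, fun n => ?_⟩
  · beta_reduce
    rw [e]
    exact isPre_pre _ _
  · obtain ⟨k, hk⟩ := h2 n
    obtain ⟨l, hl⟩ := h4 n
    refine ⟨max k l, ?_⟩
    have h5 := (mφ _ _ (pre_prefix_pre p (le_max_left k l))).length_le
    have h6 := (mψ _ _ (pre_prefix_pre p (le_max_right k l))).length_le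
    beta_reduce
    rw [e, length_pre]
    omega

theorem computableMap_id : ComputableMap fun p => Part.some p := by
  refine computableMap_of_linear_use (f := fun p => p) 1 one_pos
    (c := fun σ n => σ.getD n 0) (Primrec.list_getD 0).to_comp fun p n => ?_
  rw [getD_pre _ (by omega)]

theorem computableMap_pairFst : ComputableMap fun p => Part.some (pairFst p) := by
  refine computableMap_of_linear_use 2 two_pos (c := fun σ n => σ.getD (2 * n) 0)
    ((Primrec.list_getD 0).comp Primrec.fst
      (Primrec.nat_mul.comp (Primrec.const 2) Primrec.snd)).to_comp fun p n => ?_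
  rw [getD_pre _ (by omega), pairFst]

theorem computableMap_pairSnd : ComputableMap fun p => Part.some (pairSnd p) := by
  refine computableMap_of_linear_use 2 two_pos (c := fun σ n => σ.getD (2 * n + 1) 0)
    ((Primrec.list_getD 0).comp Primrec.fst (Primrec.nat_add.comp
      (Primrec.nat_mul.comp (Primrec.const 2) Primrec.snd) (Primrec.const 1))).to_comp fun p n => ?_
  rw [getD_pre _ (by omega), pairSnd]

theorem computableMap_zero : ComputableMap fun _ => Part.some fun _ => 0 :=
  computableMap_of_linear_use (f := fun _ _ => 0) 1 one_pos (c := fun _ _ => 0)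
    (Computable.const 0).to₂ fun _ _ => rfl

/-- If membership of `x` in an open set `U d` is witnessed by a computable property of prefixes of
`d` and `x` of equal length, then a name of `U d` can be computed from `d`. -/
theorem exists_computableMap_enumOpen {R : List ℕ → List ℕ → Prop}
    (hR : ComputablePred fun x : List ℕ × List ℕ => R x.1 x.2) :
    ∃ f : Baire → Baire, ComputableMap (fun d => Part.some (f d)) ∧
      ∀ d x, x ∈ enumOpen (f d) ↔ ∃ k, R (pre d k) (pre x k) := by
  classical
  have hdec := hR.decide
  let c : List ℕ → ℕ → ℕ := fun δ n =>
    bif decide (R (δ.take (Denumerable.ofNat (List ℕ) n).length) (Denumerable.ofNat (List ℕ) n))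
      then Encodable.encode (some (Denumerable.ofNat (List ℕ) n))
      else Encodable.encode (none : Option (List ℕ))
  have hof : Computable fun x : List ℕ × ℕ => Denumerable.ofNat (List ℕ) x.2 :=
    (Computable.ofNat _).comp Computable.snd
  have hc : Computable₂ c := by
    refine Computable.cond ?_ (Computable.encode.comp (Computable.option_some.comp hof))
      (Computable.const _)
    exact hdec.comp (Computable.pair
      (Primrec.list_take.to_comp.comp (Computable.list_length.comp hof) Computable.fst) hof)
  refine ⟨fun d n => c (pre d (1 * (n + 1))) n,
    computableMap_of_linear_use 1 one_pos hc fun _ _ => rfl, fun d x => ?_⟩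
  -- A string is no longer than its code, so the prefix of `d` read for entry `n` suffices.
  have key : ∀ n, (pre d (1 * (n + 1))).take (Denumerable.ofNat (List ℕ) n).length =
      pre d (Denumerable.ofNat (List ℕ) n).length := by
    intro n
    have := Encodable.length_le_encode (Denumerable.ofNat (List ℕ) n)
    rw [Denumerable.encode_ofNat] at this
    exact take_pre d (by omega)
  constructor
  · rintro ⟨n, σ, h, hσ⟩
    simp only [c, key] at h
    by_cases hd : R (pre d (Denumerable.ofNat (List ℕ) n).length) (Denumerable.ofNat (List ℕ) n)
    · rw [decide_eq_true hd, cond_true, Denumerable.ofNat_encode, Option.some_inj] at h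
      subst h
      refine ⟨(Denumerable.ofNat (List ℕ) n).length, ?_⟩
      rw [hσ]
      exact hd
    · rw [decide_eq_false hd, cond_false, Denumerable.ofNat_encode] at h
      cases h
  · rintro ⟨k, hk⟩
    refine ⟨Encodable.encode (pre x k), pre x k, ?_, isPre_pre _ _⟩
    simp only [c, key]
    rw [Denumerable.ofNat_encode, length_pre, decide_eq_true hk, cond_true,
      Denumerable.ofNat_encode]

/-! ### Uniform stages by compactness -/

theorem mem_sections_map_range {L : ℕ → List ℕ} {k : ℕ} {v : List ℕ} :
    v ∈ ((List.range k).map L).sections ↔ v.length = k ∧ ∀ i < k, v.getD i 0 ∈ L i := by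
  rw [List.mem_sections, List.forall₂_iff_get]
  simp only [List.length_map, List.length_range, List.get_eq_getElem, List.getElem_map,
    List.getElem_range]
  refine and_congr_right fun hv => ⟨fun h i hi => ?_, fun h i hi hi' => ?_⟩
  · rw [List.getD_eq_getElem _ _ (hv ▸ hi)]
    exact h i (hv ▸ hi) hi
  · have := h i hi'
    rwa [List.getD_eq_getElem _ _ hi] at this

theorem pairwise_pre_of_strictMono {p : Baire} (hp : StrictMono p) (n : ℕ) :
    (pre p n).Pairwise (· < ·) := by
  rw [List.pairwise_iff_getElem]
  intro i j hi hj hij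
  simpa using hp hij

theorem strictMono_of_pairwise_pre {p : Baire} (hp : ∀ m, ∃ n, m ≤ n ∧ (pre p n).Pairwise (· < ·)) :
    StrictMono p := by
  intro i j hij
  obtain ⟨n, hn, h⟩ := hp (j + 1)
  rw [List.pairwise_iff_getElem] at h
  have := h i j (by rw [length_pre]; omega) (by rw [length_pre]; omega) hij
  rwa [getElem_pre, getElem_pre] at this

theorem exists_strictMono_isPre {f : Baire} (hf : StrictMono f) {σ : List ℕ} {n : ℕ}
    (hsort : σ.Pairwise (· < ·)) (hsub : ∀ a ∈ σ, a ∈ pre f n) :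
    ∃ e : Baire, StrictMono e ∧ IsPre σ (f ∘ e) := by
  have hind : ∀ i, ∃ j, ∀ hi : i < σ.length, j < n ∧ f j = σ[i] := fun i => by
    by_cases hi : i < σ.length
    · obtain ⟨j, hj⟩ := mem_pre.1 (hsub _ (List.getElem_mem hi))
      exact ⟨j, fun _ => hj⟩
    · exact ⟨0, fun h => absurd h hi⟩
  choose e he using hind
  rw [List.pairwise_iff_getElem] at hsort
  refine ⟨fun i => if i < σ.length then e i else n + i, fun i j hij => ?_, ?_⟩
  · beta_reduce
    split_ifs with hi hj hj
    · rw [← hf.lt_iff_lt, (he i hi).2, (he j hj).2]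
      exact hsort i j hi hj hij
    · exact (he i hi).1.trans_le (Nat.le_add_right _ _)
    · omega
    · omega
  · rw [isPre_iff]
    intro i hi
    rw [Function.comp_apply, if_pos hi, (he i hi).2]

/-- If all subsequences of `f` lie in an open set, then those that take their `j`-th value in the
finite set `L j` are caught at a common finite stage of the enumeration. -/
theorem exists_uniform_stage {b f : Baire} (hf : StrictMono f)
    (hb : ∀ g : Baire, StrictMono g → f ∘ g ∈ enumOpen b) {L : ℕ → List ℕ}
    (hL : ∀ j, ∀ a ∈ L j, ∃ i, f i = a) (hne : ∀ j, ∃ a, a ∈ L j) :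
    ∃ m, ∀ k, m ≤ k → ∀ v ∈ ((List.range k).map L).sections, v.Pairwise (· < ·) →
      ∃ σ ∈ strings (pre b m), σ <+: v := by
  let U : ℕ → Set Baire := fun m =>
    {v | ∃ τ : List ℕ, (τ.length ≤ m ∧ (τ ∈ strings (pre b m) ∨ ¬ τ.Pairwise (· < ·))) ∧ IsPre τ v}
  have hU : ∀ m, IsOpen (U m) := fun m => by
    have : U m = ⋃ τ : List ℕ, ⋃ _ : τ.length ≤ m ∧ (τ ∈ strings (pre b m) ∨
        ¬ τ.Pairwise (· < ·)), {v : Baire | IsPre τ v} := by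
      ext v; simp [U]
    rw [this]
    exact isOpen_iUnion fun τ => isOpen_iUnion fun _ => isOpen_cylinder τ
  have hmono : Monotone U := by
    rintro m n hmn v ⟨τ, ⟨h1, h2⟩, h3⟩
    exact ⟨τ, ⟨h1.trans hmn, h2.imp_left fun h => strings_pre_mono b hmn h⟩, h3⟩
  have hK : IsCompact (Set.univ.pi fun j => {a | a ∈ L j} : Set Baire) :=
    isCompact_univ_pi fun j => (L j).finite_toSet.isCompact
  have hcov : (Set.univ.pi fun j => {a | a ∈ L j} : Set Baire) ⊆ ⋃ m, U m := by
    intro v hv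
    rw [Set.mem_iUnion]
    by_cases hmv : StrictMono v
    · choose g hg using fun j => hL j (v j) (hv j (Set.mem_univ j))
      have hg' : StrictMono g := fun i j hij => by
        rw [← hf.lt_iff_lt, hg, hg]
        exact hmv hij
      have := hb g hg'
      rw [show f ∘ g = v from funext hg, mem_enumOpen] at this
      obtain ⟨n, σ, hσ, hσv⟩ := this
      exact ⟨max n σ.length, σ, ⟨le_max_right _ _,
        Or.inl (strings_pre_mono b (le_max_left _ _) hσ)⟩, hσv⟩
    · by_contra hcon
      refine hmv (strictMono_of_pairwise_pre fun m => ⟨m, le_rfl, ?_⟩)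
      by_contra hp
      exact hcon ⟨m, pre v m, ⟨by simp, Or.inr hp⟩, isPre_pre v m⟩
  obtain ⟨m, hm⟩ := hK.elim_directed_cover U hU hcov hmono.directed_le
  refine ⟨m, fun k hk v hv hsort => ?_⟩
  obtain ⟨hlen, hmem⟩ := mem_sections_map_range.1 hv
  choose a ha using hne
  let w : Baire := fun n => if n < k then v.getD n 0 else a n
  have hw : w ∈ (Set.univ.pi fun j => {a | a ∈ L j} : Set Baire) := fun j _ => by
    change w j ∈ L j
    by_cases hj : j < k
    · simp only [w, if_pos hj]; exact hmem j hj
    · simp only [w, if_neg hj]; exact ha j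
  have hwv : pre w k = v := by
    apply List.ext_getElem
    · simp [hlen]
    · intro i h1 h2
      rw [length_pre] at h1
      simp [w, h1, h2]
  obtain ⟨τ, ⟨h1, h2⟩, h3⟩ := hm hw
  have hτ : τ <+: v := hwv ▸ h3.prefix_pre (h1.trans hk)
  exact ⟨τ, h2.resolve_right (not_not.2 (hsort.sublist hτ.sublist)), hτ⟩

/-! ### The combined Ramsey problem -/

/-- The string coded by the `i`-th entry of `ρ`. -/
def codedString (ρ : List ℕ) (i : ℕ) : List ℕ := Denumerable.ofNat (List ℕ) (ρ.getD i 0)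

/-- In a prefix of a tag followed by the pair `⟨f, x⟩`, the part that belongs to `f`. -/
def ramseyPart (s : List ℕ) : List ℕ := evens s.tail

/-- The closed conditions on the string `s`, a prefix of a tag followed by `y = ⟨f, x⟩`, relative to
a prefix `δ` of `⟨r, b⟩`: `f` is strictly increasing, `y` is not in the open set named by `r`, and,
if the tag is `0`, no subsequence of `f` is in the open set named by `b`. -/
def Consistent (δ s : List ℕ) : Prop :=
  (ramseyPart s).Pairwise (· < ·) ∧ (∀ σ ∈ strings (evens δ), ¬ σ <+: s.tail) ∧
    (s.headI = 0 → ∀ σ ∈ strings (odds δ),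
      ¬ (σ.Pairwise (· < ·) ∧ ∀ a ∈ σ, a ∈ ramseyPart s))

/-- All strictly increasing sequences whose `j`-th term occurs in the string coded by the `j`-th
entry of `ρ` are seen to lie in the open set named by the second half of `δ`. -/
def Lands (δ ρ : List ℕ) : Prop :=
  ∀ v ∈ (ρ.map fun c => ramseyPart (Denumerable.ofNat (List ℕ) c)).sections,
    v.Pairwise (· < ·) → ∃ σ ∈ strings (odds δ), σ <+: v

/-- The condition under which the cylinder of `ρ` belongs to the open set whose homogeneous
elements code a homogeneous `f` for the open set named by `b`, together with an `x` such that
`⟨f, x⟩` avoids the open set named by `r`; here `δ` is a prefix of `⟨r, b⟩`. -/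
def Accepts (δ ρ : List ℕ) : Prop :=
  2 ≤ ρ.length ∧ codedString ρ 0 <+: codedString ρ 1 ∧ (codedString ρ 1).length ≤ δ.length ∧
    Consistent (δ.take (codedString ρ 1).length) (codedString ρ 1) ∧
      ((codedString ρ 1).headI = 0 ∨ Lands δ ρ)

section Primrec

open Primrec

theorem primrec_codedString (i : ℕ) : Primrec fun ρ => codedString ρ i :=
  (Primrec.ofNat (List ℕ)).comp ((list_getD 0).comp Primrec.id (const i))

theorem primrec_ramseyPart : Primrec ramseyPart := primrec_evens.comp list_tail

theorem primrecRel_consistent : PrimrecRel Consistent := by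
  have hs : Primrec fun x : List ℕ × List ℕ => ramseyPart x.2 := primrec_ramseyPart.comp snd
  have h1 : PrimrecRel fun σ t : List ℕ => ¬ σ <+: t := primrecRel_prefix.not
  have h2 : PrimrecRel fun σ t : List ℕ => ¬ (σ.Pairwise (· < ·) ∧ ∀ a ∈ σ, a ∈ t) :=
    ((primrecPred_sorted.comp fst).and primrecRel_subset).not
  refine (primrecPred_sorted.comp hs).and (PrimrecPred.and ?_ (PrimrecPred.of_eq
    (PrimrecPred.or ?_ ?_) fun x => imp_iff_not_or.symm))
  · exact h1.forall_mem_list.comp (primrec_strings.comp (primrec_evens.comp fst))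
      (list_tail.comp snd)
  · exact (Primrec.eq.comp (list_headI.comp snd) (const 0)).not
  · exact h2.forall_mem_list.comp (primrec_strings.comp (primrec_odds.comp fst)) hs

theorem primrecRel_lands : PrimrecRel Lands := by
  have h1 : PrimrecRel fun (v : List ℕ) (S : List (List ℕ)) => ∃ σ ∈ S, σ <+: v :=
    primrecRel_prefix.exists_mem_list.comp snd fst
  have h2 : PrimrecRel fun (v : List ℕ) (S : List (List ℕ)) =>
      v.Pairwise (· < ·) → ∃ σ ∈ S, σ <+: v :=
    ((primrecPred_sorted.comp fst).not.or h1).of_eq fun x => imp_iff_not_or.symm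
  refine h2.forall_mem_list.comp (primrec_sections.comp (list_map snd ?_))
    (primrec_strings.comp (primrec_odds.comp fst))
  exact (primrec_ramseyPart.comp ((Primrec.ofNat (List ℕ)).comp snd)).to₂

theorem primrecRel_accepts : PrimrecRel Accepts := by
  have h0 : Primrec fun x : List ℕ × List ℕ => codedString x.2 0 := (primrec_codedString 0).comp snd
  have h1 : Primrec fun x : List ℕ × List ℕ => codedString x.2 1 := (primrec_codedString 1).comp snd
  have hl := list_length.comp h1
  exact (nat_le.comp (const 2) (list_length.comp snd)).and <| (primrecRel_prefix.comp h0 h1).and <|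
    (nat_le.comp hl (list_length.comp fst)).and <|
      (primrecRel_consistent.comp (list_take.comp hl fst) h1).and <|
        (Primrec.eq.comp (list_headI.comp h1) (const 0)).or primrecRel_lands

end Primrec

theorem tail_pre (z : Baire) (n : ℕ) : (pre z n).tail = pre (fun i => z (i + 1)) (n - 1) := by
  apply List.ext_getElem <;> simp

theorem ramseyPart_pre (z : Baire) (n : ℕ) :
    ramseyPart (pre z n) = pre (pairFst fun i => z (i + 1)) ((n - 1) / 2) := by
  rw [ramseyPart, tail_pre, evens_pre]

theorem headI_pre (z : Baire) {n : ℕ} (h : 0 < n) : (pre z n).headI = z 0 := by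
  obtain ⟨n, rfl⟩ := Nat.exists_eq_succ_of_ne_zero h.ne'
  simp [pre, List.range_succ_eq_map]

theorem encode_lt_encode_append_singleton (l : List ℕ) (a : ℕ) :
    Encodable.encode l < Encodable.encode (l ++ [a]) := by
  induction l with
  | nil => simp
  | cons b l ih =>
    simp only [List.cons_append, Encodable.encode_list_cons]
    exact Nat.succ_lt_succ (Nat.pair_lt_pair_right _ ih)

theorem strictMono_encode_pre (z : Baire) : StrictMono fun n => Encodable.encode (pre z n) :=
  strictMono_nat_of_lt_succ fun n => by
    have : pre z (n + 1) = pre z n ++ [z n] := by simp [pre, List.range_succ]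
    rw [this]
    exact encode_lt_encode_append_singleton _ _

theorem codedString_pre (h : Baire) {i k : ℕ} (hi : i < k) :
    codedString (pre h k) i = Denumerable.ofNat (List ℕ) (h i) := by
  rw [codedString, getD_pre _ hi]

/-- An element `f` of `HS(P)` and a point `y = ⟨f, x⟩` outside the open set named by the first half
of `d` yield a sequence all of whose subsequences are accepted: the codes of the prefixes of `y`,
with a tag telling whether the subsequences of `f` are outside or inside `P`. -/
theorem exists_accepted {d y : Baire} (f : Ramsey)
    (hf : f ∈ HS {f : Ramsey | f.1 ∈ enumOpen (pairSnd d)}) (hy : pairFst y = f.1)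
    (hyd : y ∉ enumOpen (pairFst d)) :
    ∃ h : Ramsey, ∀ g : Ramsey, ∃ k, Accepts (pre d k) (pre (h.comp g).1 k) := by
  classical
  let t : ℕ := if ∀ g : Ramsey, f.comp g ∉ {f : Ramsey | f.1 ∈ enumOpen (pairSnd d)} then 0 else 1
  let z : Baire := fun n => Nat.casesOn n t y
  -- Prefixes of length at least `3` contain a term of `f`.
  refine ⟨⟨fun n => Encodable.encode (pre z (n + 3)),
    (strictMono_encode_pre z).comp fun m n h => Nat.add_lt_add_right h 3⟩, fun g => ?_⟩
  have hof : ∀ j, Denumerable.ofNat (List ℕ) (Encodable.encode (pre z (g.1 j + 3))) =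
    pre z (g.1 j + 3) := fun j => Denumerable.ofNat_encode _
  have hz : (fun i => z (i + 1)) = y := rfl
  have h01 : g.1 0 < g.1 1 := g.2 Nat.zero_lt_one
  -- From this stage on everything but the last clause holds.
  have main : ∀ k, g.1 1 + 3 ≤ k → (z 0 = 0 ∨
      Lands (pre d k) (pre (fun n => Encodable.encode (pre z (g.1 n + 3))) k)) →
      Accepts (pre d k) (pre (fun n => Encodable.encode (pre z (g.1 n + 3))) k) := by
    intro k hk hlast
    rw [Accepts, codedString_pre _ (by omega), codedString_pre _ (by omega), hof, hof, length_pre,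
      length_pre, length_pre, take_pre d hk, headI_pre _ (by omega)]
    refine ⟨by omega, pre_prefix_pre _ (by omega), hk, ⟨?_, ?_, ?_⟩, hlast⟩
    · rw [ramseyPart_pre, hz, hy]
      exact pairwise_pre_of_strictMono f.2 _
    · intro σ hσ hpre
      rw [evens_pre] at hσ
      rw [tail_pre, hz] at hpre
      exact hyd (mem_enumOpen.2 ⟨_, σ, hσ, isPre_of_prefix_pre hpre⟩)
    · rintro hz0 σ hσ ⟨hsort, hsub⟩
      rw [headI_pre _ (by omega)] at hz0
      rw [odds_pre] at hσ
      rw [ramseyPart_pre, hz, hy] at hsub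
      have havoid : ∀ g : Ramsey, f.comp g ∉ {f : Ramsey | f.1 ∈ enumOpen (pairSnd d)} := by
        by_contra hcon
        exact one_ne_zero ((if_neg hcon).symm.trans hz0)
      obtain ⟨e, he, heσ⟩ := exists_strictMono_isPre f.2 hsort hsub
      exact havoid ⟨e, he⟩ (mem_enumOpen.2 ⟨_, σ, hσ, heσ⟩)
  rcases hf with hland | havoid
  · have hL : ∀ j, ∀ a ∈ ramseyPart (pre z (g.1 j + 3)), ∃ i, f.1 i = a := by
      intro j a ha
      rw [ramseyPart_pre, hz, hy, mem_pre] at ha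
      obtain ⟨i, _, hi⟩ := ha
      exact ⟨i, hi⟩
    have hne : ∀ j, ∃ a, a ∈ ramseyPart (pre z (g.1 j + 3)) := by
      intro j
      refine ⟨f.1 0, ?_⟩
      rw [ramseyPart_pre, hz, hy, mem_pre]
      exact ⟨0, by omega, rfl⟩
    obtain ⟨m, hm⟩ := exists_uniform_stage f.2 (fun e he => hland ⟨e, he⟩) hL hne
    refine ⟨max (2 * m) (g.1 1 + 3), main _ (le_max_right _ _) (Or.inr ?_)⟩
    intro v hv hsort
    rw [pre, List.map_map, Function.comp_def] at hv
    simp only [hof] at hv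
    obtain ⟨σ, hσ, hσv⟩ := hm _ (by omega) v hv hsort
    refine ⟨σ, ?_, hσv⟩
    rw [odds_pre]
    exact strings_pre_mono _ (by omega) hσ
  · exact ⟨g.1 1 + 3, main _ le_rfl (Or.inl (if_pos havoid))⟩

/-- The pair `⟨f, x⟩` read off from a sequence of codes of longer and longer prefixes of a tag
followed by it. -/
def decodeSolution (h : Baire) : Baire := fun n =>
  (Denumerable.ofNat (List ℕ) (h (n + 2))).getD (n + 1) 0

/-- Conversely to `exists_accepted`, a solution is decoded from any sequence all of whose
subsequences are accepted. -/
theorem decodeSolution_spec {d : Baire} {h : Ramsey}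
    (H : ∀ g : Ramsey, ∃ k, Accepts (pre d k) (pre (h.comp g).1 k)) :
    decodeSolution h.1 ∉ enumOpen (pairFst d) ∧
      ∃ hf : StrictMono (pairFst (decodeSolution h.1)),
        (⟨_, hf⟩ : Ramsey) ∈ HS {f : Ramsey | f.1 ∈ enumOpen (pairSnd d)} := by
  let s : ℕ → List ℕ := fun i => Denumerable.ofNat (List ℕ) (h.1 i)
  have H' : ∀ g : Ramsey, s (g.1 0) <+: s (g.1 1) ∧
      Consistent (pre d (s (g.1 1)).length) (s (g.1 1)) ∧
        ((s (g.1 1)).headI = 0 ∨ ∃ k, Lands (pre d k) (pre (h.1 ∘ g.1) k)) := by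
    intro g
    obtain ⟨k, h1, h2, h3, h4, h5⟩ := H g
    rw [length_pre] at h1 h3
    rw [codedString_pre _ (by omega)] at h2 h3 h4 h5
    rw [codedString_pre _ (by omega)] at h2
    rw [take_pre d h3] at h4
    exact ⟨h2, h4, h5.imp_right fun h => ⟨k, h⟩⟩
  have hpair : ∀ i j, i < j → s i <+: s j ∧ Consistent (pre d (s j).length) (s j) := by
    intro i j hij
    have := H' ⟨fun n => if n = 0 then i else j + n - 1, fun m n hmn => by
      dsimp only; split_ifs <;> omega⟩
    exact ⟨this.1, this.2.1⟩
  have hlen : StrictMono fun i => (s i).length := fun i j hij => by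
    have hp := (hpair i j hij).1
    refine lt_of_le_of_ne hp.length_le fun e => (h.2 hij).ne ?_
    have : s i = s j := hp.eq_of_length e
    rw [← Denumerable.encode_ofNat (α := List ℕ) (h.1 i),
      ← Denumerable.encode_ofNat (α := List ℕ) (h.1 j)]
    exact congrArg _ this
  let z : Baire := fun n => (s (n + 1)).getD n 0
  have hsz : ∀ i, s i = pre z (s i).length := by
    intro i
    apply List.ext_getElem
    · simp
    · intro n h1 h2
      have h3 : n < (s (n + 1)).length := hlen.le_apply (x := n + 1)
      rw [getElem_pre, show z n = _ from List.getD_eq_getElem _ _ h3]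
      rcases lt_trichotomy i (n + 1) with hi | rfl | hi
      · exact (hpair _ _ hi).1.getElem h1
      · rfl
      · exact ((hpair _ _ hi).1.getElem h3).symm
  have hy : (fun i => z (i + 1)) = decodeSolution h.1 := rfl
  have hcons : ∀ j, Consistent (pre d (s (j + 1)).length) (pre z (s (j + 1)).length) := by
    intro j
    have := (hpair j (j + 1) j.lt_succ_self).2
    rwa [hsz (j + 1), length_pre] at this
  have hbig : ∀ j, j < (s (j + 1)).length := fun j => hlen.le_apply (x := j + 1)
  have hmono : StrictMono (pairFst (decodeSolution h.1)) := by
    refine strictMono_of_pairwise_pre fun m => ⟨((s (2 * m + 1)).length - 1) / 2, ?_, ?_⟩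
    · have := hbig (2 * m)
      omega
    · have := (hcons (2 * m)).1
      rwa [ramseyPart_pre, hy] at this
  refine ⟨fun hmem => ?_, hmono, ?_⟩
  · obtain ⟨n, σ, hσ, hσy⟩ := mem_enumOpen.1 hmem
    have hb := hbig (2 * (n + σ.length) + 1)
    have := (hcons (2 * (n + σ.length) + 1)).2.1 σ
    rw [evens_pre, tail_pre, hy] at this
    exact this (strings_pre_mono _ (by omega) hσ) (hσy.prefix_pre (by omega))
  · by_cases hz : z 0 = 0
    · refine Or.inr fun g hg => ?_
      obtain ⟨n, σ, hσ, hσg⟩ := mem_enumOpen.1 hg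
      obtain ⟨m, hm⟩ : ∃ m, ∀ i < σ.length, g.1 i < m :=
        ⟨g.1 σ.length, fun i hi => g.2 hi⟩
      have hb := hbig (2 * (n + m) + 1)
      have := (hcons (2 * (n + m) + 1)).2.2 (by rwa [headI_pre _ (by omega)]) σ
      rw [odds_pre, ramseyPart_pre, hy] at this
      refine this (strings_pre_mono _ (by omega) hσ) ⟨?_, fun a ha => ?_⟩
      · rw [← hσg]
        exact pairwise_pre_of_strictMono (hmono.comp g.2) _
      · obtain ⟨i, hi, rfl⟩ := List.getElem_of_mem ha
        rw [← (isPre_iff _ _).1 hσg i hi, mem_pre]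
        have := hm i hi
        exact ⟨g.1 i, by omega, rfl⟩
    · refine Or.inl fun g => ?_
      -- The `j`-th string of this subsequence is long enough to contain the `g j`-th term of `f`.
      let e : Ramsey := ⟨fun j => 2 * g.1 j + 3, fun i j hij => by
        have := g.2 hij
        dsimp only
        omega⟩
      have he := (H' e).2.2
      have hpos : 0 < (s (e.1 1)).length :=
        (Nat.succ_pos _).trans_le (hlen.le_apply (x := e.1 1))
      rw [hsz (e.1 1), headI_pre _ hpos] at he
      obtain ⟨k, hk⟩ := he.resolve_left hz
      obtain ⟨σ, hσ, hσg⟩ := hk (pre (pairFst (decodeSolution h.1) ∘ g.1) k) (by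
        have hmap : ((pre (h.1 ∘ e.1) k).map fun c => ramseyPart (Denumerable.ofNat (List ℕ) c)) =
            (List.range k).map fun j => ramseyPart (s (e.1 j)) := by
          rw [pre, List.map_map]
          rfl
        rw [hmap, mem_sections_map_range, length_pre]
        refine ⟨rfl, fun i hi => ?_⟩
        rw [getD_pre _ hi]
        rw [hsz, ramseyPart_pre, hy, mem_pre]
        have := hlen.le_apply (x := e.1 i)
        refine ⟨g.1 i, ?_, rfl⟩
        dsimp [e] at this ⊢
        omega) (pairwise_pre_of_strictMono (hmono.comp g.2) _)
      rw [odds_pre] at hσ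
      exact mem_enumOpen.2 ⟨_, σ, hσ, isPre_of_prefix_pre hσg⟩

theorem computableMap_decodeSolution :
    ComputableMap fun p => Part.some (decodeSolution (pairSnd p)) := by
  have hn : Primrec fun x : List ℕ × ℕ => 2 * (x.2 + 2) + 1 := Primrec.nat_add.comp
    (Primrec.nat_mul.comp (Primrec.const 2)
      (Primrec.nat_add.comp Primrec.snd (Primrec.const 2))) (Primrec.const 1)
  refine computableMap_of_linear_use (f := fun p => decodeSolution (pairSnd p)) 6 (by norm_num)
    (c := fun σ n =>
      (Denumerable.ofNat (List ℕ) (σ.getD (2 * (n + 2) + 1) 0)).getD (n + 1) 0) ?_ fun p n => ?_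
  · exact ((Primrec.list_getD 0).comp ((Primrec.ofNat (List ℕ)).comp
      ((Primrec.list_getD 0).comp Primrec.fst hn)) (Primrec.succ.comp Primrec.snd)).to_comp
  · rw [getD_pre _ (by omega), decodeSolution, pairSnd]

/-! ### Weihrauch reductions -/

theorem mem_delta_baire {p x : Baire} : x ∈ RepresentedSpace.δ (X := Baire) p ↔ x = p :=
  Part.mem_some_iff

theorem mem_delta_ramsey {p : Baire} {f : Ramsey} :
    f ∈ RepresentedSpace.δ (X := Ramsey) p ↔ f.1 = p := by
  constructor
  · rintro ⟨_, rfl⟩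
    rfl
  · rintro rfl
    exact ⟨f.2, rfl⟩

theorem mem_delta_closeds {p : Baire} {A : Closeds Baire} :
    A ∈ RepresentedSpace.δ (X := Closeds Baire) p ↔ (A : Set Baire) = (enumOpen p)ᶜ := by
  refine Part.mem_some_iff.trans ⟨?_, fun h => Closeds.ext h⟩
  rintro rfl
  rfl

theorem mem_delta_opens {p : Baire} {U : Opens Ramsey} :
    U ∈ RepresentedSpace.δ (X := Opens Ramsey) p ↔
      (U : Set Ramsey) = {f : Ramsey | f.1 ∈ enumOpen p} := by
  refine Part.mem_some_iff.trans ⟨?_, fun h => Opens.ext h⟩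
  rintro rfl
  rfl

theorem delta_unique {X : Type*} [RepresentedSpace X] {p : Baire} {x y : X}
    (hx : x ∈ RepresentedSpace.δ (X := X) p) (hy : y ∈ RepresentedSpace.δ (X := X) p) : x = y :=
  Part.mem_unique hx hy

theorem exists_delta_opens (p : Baire) : ∃ U : Opens Ramsey,
    U ∈ RepresentedSpace.δ (X := Opens Ramsey) p ∧
      (U : Set Ramsey) = {f : Ramsey | f.1 ∈ enumOpen p} :=
  ⟨_, Part.mem_some _, rfl⟩

theorem exists_delta_closeds (p : Baire) : ∃ A : Closeds Baire,
    A ∈ RepresentedSpace.δ (X := Closeds Baire) p ∧ (A : Set Baire) = (enumOpen p)ᶜ :=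
  ⟨_, Part.mem_some _, rfl⟩

theorem mem_bind_map_pair {F G : Part Baire} {a b : Baire} (ha : a ∈ F) (hb : b ∈ G) :
    pair a b ∈ F.bind fun a => G.map fun b => pair a b :=
  Part.mem_bind ha (Part.mem_map _ hb)

section Reductions

variable {X : Type*} {Y : Type*} {Z : Type*} {W : Type*} {S : Type*} {T : Type*}
  [RepresentedSpace X] [RepresentedSpace Y] [RepresentedSpace Z] [RepresentedSpace W]
  [RepresentedSpace S] [RepresentedSpace T]

/-- A pointwise criterion for Weihrauch reducibility, without realizers. -/
theorem WReducible.of_forall {f : MultiFun X Y} {g : MultiFun Z W} {Φ Ψ : Baire →. Baire}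
    (hΦ : ComputableMap Φ) (hΨ : ComputableMap Ψ)
    (H : ∀ p, ∀ x ∈ RepresentedSpace.δ (X := X) p, x ∈ f.dom → ∃ a ∈ Φ p,
      ∃ z ∈ RepresentedSpace.δ (X := Z) a, z ∈ g.dom ∧
        ∀ b, ∀ w ∈ RepresentedSpace.δ (X := W) b, w ∈ g z →
          ∃ q ∈ Ψ (Weihrauch.pair p b), ∃ y ∈ RepresentedSpace.δ (X := Y) q, y ∈ f x) :
    WReducible f g := by
  refine ⟨Φ, Ψ, hΦ, hΨ, fun G hG p x hx hdom => ?_⟩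
  obtain ⟨a, ha, z, hz, hzdom, hsol⟩ := H p x hx hdom
  obtain ⟨b, hb, w, hw, hwz⟩ := hG a z hz hzdom
  obtain ⟨q, hq, hy⟩ := hsol b w hw hwz
  exact ⟨q, Part.mem_bind_iff.2 ⟨a, ha, Part.mem_bind_iff.2 ⟨b, hb, hq⟩⟩, hy⟩

/-- The converse of `WReducible.of_forall`. The realizers of `g` used are those that are defined
only on names of instances, with one prescribed value. -/
theorem WReducible.exists_forall {f : MultiFun X Y} {g : MultiFun Z W} (h : WReducible f g) :
    ∃ Φ Ψ : Baire →. Baire, ComputableMap Φ ∧ ComputableMap Ψ ∧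
      ∀ p, ∀ x ∈ RepresentedSpace.δ (X := X) p, x ∈ f.dom → ∃ a ∈ Φ p,
        ∃ z ∈ RepresentedSpace.δ (X := Z) a, z ∈ g.dom ∧
          ∀ b, ∀ w ∈ RepresentedSpace.δ (X := W) b, w ∈ g z →
            ∃ q ∈ Ψ (Weihrauch.pair p b), ∃ y ∈ RepresentedSpace.δ (X := Y) q, y ∈ f x := by
  classical
  obtain ⟨Φ, Ψ, hΦ, hΨ, H⟩ := h
  refine ⟨Φ, Ψ, hΦ, hΨ, fun p x hx hdom => ?_⟩
  let Sol : Baire → Baire → Prop := fun a b =>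
    ∃ z ∈ RepresentedSpace.δ (X := Z) a, ∃ w ∈ RepresentedSpace.δ (X := W) b, w ∈ g z
  have hreal : ∀ a₀ b₀, Sol a₀ b₀ → ∃ G : Baire →. Baire, IsRealizer G g ∧
      (∀ a, ∀ b ∈ G a, Sol a b) ∧ ∀ b ∈ G a₀, b = b₀ := by
    intro a₀ b₀ h₀
    refine ⟨fun a => ⟨∃ b, Sol a b, fun h => if a = a₀ then b₀ else h.choose⟩, ?_, ?_, ?_⟩
    · rintro a z hz ⟨w, hw⟩
      obtain ⟨b, hb⟩ := RepresentedSpace.surj w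
      have hab : ∃ b, Sol a b := ⟨b, z, hz, w, hb, hw⟩
      refine ⟨_, ⟨hab, rfl⟩, ?_⟩
      have : Sol a (if a = a₀ then b₀ else hab.choose) := by
        split_ifs with e
        · rwa [e]
        · exact hab.choose_spec
      obtain ⟨z', hz', w', hw', hs⟩ := this
      rw [delta_unique hz' hz] at hs
      exact ⟨w', hw', hs⟩
    · rintro a b ⟨hab, rfl⟩
      change Sol a (if a = a₀ then b₀ else hab.choose)
      split_ifs with e
      · rwa [e]
      · exact hab.choose_spec
    · rintro b ⟨hab, rfl⟩
      exact if_pos rfl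
  -- Some realizer exists even if `g` has no instances.
  obtain ⟨a, ha, b, hab⟩ : ∃ a ∈ Φ p, ∃ b, Sol a b := by
    by_cases hex : ∃ a b, Sol a b
    · obtain ⟨a₀, b₀, h₀⟩ := hex
      obtain ⟨G, hG, hG', -⟩ := hreal a₀ b₀ h₀
      obtain ⟨q, hq, -⟩ := H G hG p x hx hdom
      obtain ⟨a, ha, hq⟩ := Part.mem_bind_iff.1 hq
      obtain ⟨b, hb, hq⟩ := Part.mem_bind_iff.1 hq
      exact ⟨a, ha, b, hG' a b hb⟩
    · have hG : IsRealizer (fun _ => Part.none) g := by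
        rintro a z hz ⟨w, hw⟩
        obtain ⟨b, hb⟩ := RepresentedSpace.surj w
        exact absurd ⟨a, b, z, hz, w, hb, hw⟩ hex
      obtain ⟨q, hq, -⟩ := H _ hG p x hx hdom
      obtain ⟨a, ha, hq⟩ := Part.mem_bind_iff.1 hq
      obtain ⟨b, hb, hq⟩ := Part.mem_bind_iff.1 hq
      exact absurd hb (Part.notMem_none b)
  obtain ⟨z, hz, w, hw, hwz⟩ := hab
  refine ⟨a, ha, z, hz, ⟨w, hwz⟩, fun b' w' hw' hwz' => ?_⟩
  obtain ⟨G, hG, -, hGa⟩ := hreal a b' ⟨z, hz, w', hw', hwz'⟩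
  obtain ⟨q, hq, hy⟩ := H G hG p x hx hdom
  obtain ⟨a', ha', hq'⟩ := Part.mem_bind_iff.1 hq
  obtain rfl := Part.mem_unique ha ha'
  obtain ⟨c, hc, hqc⟩ := Part.mem_bind_iff.1 hq'
  exact ⟨q, hGa c hc ▸ hqc, hy⟩

theorem WReducible.refl (f : MultiFun X Y) : WReducible f f :=
  .of_forall computableMap_id computableMap_pairSnd fun p x hx hdom =>
    ⟨p, Part.mem_some _, x, hx, hdom, fun b w hw hwx => ⟨b, by simp, w, hw, hwx⟩⟩

theorem WReducible.trans {f : MultiFun X Y} {g : MultiFun Z W} {h : MultiFun S T}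
    (hfg : WReducible f g) (hgh : WReducible g h) : WReducible f h := by
  obtain ⟨Φ, Ψ, hΦ, hΨ, H⟩ := hfg.exists_forall
  obtain ⟨Φ', Ψ', hΦ', hΨ', H'⟩ := hgh.exists_forall
  refine .of_forall (hΦ.bind hΦ') ((computableMap_pairFst.pair
    (((computableMap_pairFst.bind hΦ).pair computableMap_pairSnd).bind hΨ')).bind hΨ)
    fun p x hx hdom => ?_
  obtain ⟨a, ha, z, hz, hzdom, hsol⟩ := H p x hx hdom
  obtain ⟨c, hc, s, hs, hsdom, hsol'⟩ := H' a z hz hzdom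
  refine ⟨c, Part.mem_bind_iff.2 ⟨a, ha, hc⟩, s, hs, hsdom, fun b t ht hts => ?_⟩
  obtain ⟨b', hb', w, hw, hwz⟩ := hsol' b t ht hts
  obtain ⟨q, hq, hy⟩ := hsol b' w hw hwz
  refine ⟨q, ?_, hy⟩
  have hp : p ∈ Part.some (pairFst (Weihrauch.pair p b)) := by simp
  have hb : b ∈ Part.some (pairSnd (Weihrauch.pair p b)) := by simp
  exact Part.mem_bind (mem_bind_map_pair hp
    (Part.mem_bind (mem_bind_map_pair (Part.mem_bind hp ha) hb) hb')) hq

end Reductions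

/-! ### The compositional product of closed choice and the open Ramsey theorem -/

/-- The open Ramsey theorem with a parameter: from `⟨r, b⟩` find `⟨r, f⟩`, where `f` is homogeneous
for the open set named by `b`. -/
def paramOpenRT : MultiFun Baire Baire := fun d =>
  {v | pairFst v = pairFst d ∧ ∃ hf : StrictMono (pairSnd v),
    (⟨pairSnd v, hf⟩ : Ramsey) ∈ HS {f : Ramsey | f.1 ∈ enumOpen (pairSnd d)}}

/-- Closed choice on a section of a closed subset of the plane: from `⟨r, f⟩` find `⟨f, x⟩` outside
the open set named by `r`. -/
def sectionChoice : MultiFun Baire Baire := fun v =>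
  {y | pairFst y = pairSnd v ∧ y ∉ enumOpen (pairFst v)}

theorem sectionChoice_reducible_closedChoice : WReducible sectionChoice closedChoice := by
  let R : List ℕ → List ℕ → Prop := fun δ ρ =>
    ∃ σ ∈ strings (evens δ), σ <+: interleave (odds δ) ρ
  have hR : PrimrecRel R := primrecRel_prefix.exists_mem_list.comp
    (primrec_strings.comp (primrec_evens.comp Primrec.fst))
    (primrec_interleave.comp (primrec_odds.comp Primrec.fst) Primrec.snd)
  obtain ⟨Φ, hΦ, hmem⟩ := exists_computableMap_enumOpen (PrimrecPred.computablePred hR)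
  have key : ∀ v x, x ∈ enumOpen (Φ v) ↔ pair (pairSnd v) x ∈ enumOpen (pairFst v) := by
    intro v x
    simp only [hmem, R, evens_pre, odds_pre, interleave_pre]
    constructor
    · rintro ⟨k, σ, hσ, hpre⟩
      exact mem_enumOpen.2 ⟨_, σ, hσ, isPre_of_prefix_pre hpre⟩
    · intro h
      obtain ⟨n, σ, hσ, hpre⟩ := mem_enumOpen.1 h
      exact ⟨2 * (n + σ.length), σ, strings_pre_mono _ (by omega) hσ,
        hpre.prefix_pre (by omega)⟩
  refine .of_forall hΦ ((computableMap_pairFst.bind computableMap_pairSnd).pair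
    computableMap_pairSnd) fun p v hv hdom => ?_
  obtain rfl := mem_delta_baire.1 hv
  obtain ⟨A, hA, hA'⟩ := exists_delta_closeds (Φ v)
  have hAmem : ∀ x, x ∈ A ↔ pair (pairSnd v) x ∉ enumOpen (pairFst v) := fun x => by
    rw [← SetLike.mem_coe, hA', Set.mem_compl_iff, key]
  refine ⟨_, Part.mem_some _, A, hA, ?_, fun b x hx hxA => ?_⟩
  · obtain ⟨y, hy, hy'⟩ := hdom
    refine ⟨pairSnd y, (hAmem _).2 ?_⟩
    rwa [← hy, pair_pairFst_pairSnd]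
  · obtain rfl := mem_delta_baire.1 hx
    refine ⟨pair (pairSnd v) x, by simp, _, mem_delta_baire.2 rfl, by simp, (hAmem x).1 hxA⟩

theorem paramOpenRT_reducible_openRT : WReducible paramOpenRT openRT := by
  refine .of_forall computableMap_pairSnd
    ((computableMap_pairFst.bind computableMap_pairFst).pair computableMap_pairSnd)
    fun p d hd hdom => ?_
  obtain rfl := mem_delta_baire.1 hd
  obtain ⟨U, hU, hU'⟩ := exists_delta_opens (pairSnd d)
  refine ⟨_, Part.mem_some _, U, hU, ?_, fun b f hf hfU => ?_⟩
  · obtain ⟨v, -, hv, hv'⟩ := hdom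
    exact ⟨_, hU'.symm ▸ hv'⟩
  · obtain rfl := mem_delta_ramsey.1 hf
    refine ⟨pair (pairFst d) f.1, by simp, _, mem_delta_baire.2 rfl, by simp, ?_⟩
    have hfU' : f ∈ HS {f : Ramsey | f.1 ∈ enumOpen (pairSnd d)} := hU' ▸ hfU
    simp only [pairSnd_pair]
    exact ⟨f.2, hfU'⟩

/-- The composition is at least any other composition: from a name `p` of an instance one computes
the instance of the open Ramsey theorem and, since the closed set is determined by `p` and `f`
through a computable map, a name of the set of all `⟨f, x⟩` for which `x` is not in it. -/
theorem comp_reducible {A : Type*} {B : Type*} {C : Type*}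
    [RepresentedSpace A] [RepresentedSpace B] [RepresentedSpace C]
    {f₀ : MultiFun B C} {g₀ : MultiFun A B}
    (hf : WReducible f₀ closedChoice) (hg : WReducible g₀ openRT) :
    WReducible (f₀.comp g₀) (sectionChoice.comp paramOpenRT) := by
  obtain ⟨Φ₁, Ψ₁, hΦ₁, hΨ₁, H₁⟩ := hf.exists_forall
  obtain ⟨Φ₂, Ψ₂, hΦ₂, hΨ₂, H₂⟩ := hg.exists_forall
  obtain ⟨θ, hθ, mθ, cθ⟩ := hΨ₂.bind hΦ₁
  let R : List ℕ → List ℕ → Prop := fun δ ρ =>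
    ∃ σ ∈ strings (θ (interleave δ (evens ρ))), σ <+: odds ρ
  have hR : ComputablePred fun x : List ℕ × List ℕ => R x.1 x.2 := by
    classical
    have h1 : PrimrecRel fun l ρ : List ℕ => ∃ σ ∈ strings l, σ <+: odds ρ :=
      primrecRel_prefix.exists_mem_list.comp (primrec_strings.comp Primrec.fst)
        (primrec_odds.comp Primrec.snd)
    refine ComputablePred.of_eq (p := fun x : List ℕ × List ℕ =>
      ∃ σ ∈ strings (θ (interleave x.1 (evens x.2))), σ <+: odds x.2) ?_ fun _ => Iff.rfl
    refine ⟨fun _ => Classical.propDecidable _, ?_⟩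
    exact (h1.decide.to_comp.comp (hθ.comp (primrec_interleave.comp Primrec.fst
      (primrec_evens.comp Primrec.snd)).to_comp) Computable.snd).of_eq fun _ => by simp
  obtain ⟨E, hE, hmem⟩ := exists_computableMap_enumOpen hR
  have key : ∀ p y q, q ∈ (Ψ₂ (pair p (pairFst y))).bind Φ₁ →
      (y ∈ enumOpen (E p) ↔ pairSnd y ∈ enumOpen q) := by
    intro p y q hq
    obtain ⟨h1, h2⟩ := cθ _ q hq
    simp only [hmem, R, evens_pre, odds_pre, interleave_pre]
    constructor
    · rintro ⟨k, σ, hσ, hpre⟩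
      rw [← h1 (2 * min k (k / 2))] at hσ
      exact mem_enumOpen.2 ⟨_, σ, hσ, isPre_of_prefix_pre hpre⟩
    · intro h
      obtain ⟨n, σ, hσ, hpre⟩ := mem_enumOpen.1 h
      obtain ⟨m, hm⟩ := h2 n
      refine ⟨2 * (m + σ.length), σ, ?_, hpre.prefix_pre (by omega)⟩
      rw [← h1]
      refine strings_pre_mono _ (hm.trans (mθ _ _ (pre_prefix_pre _ ?_)).length_le) hσ
      omega
  refine .of_forall (hE.pair hΦ₂) ((((computableMap_pairFst.pair
    (computableMap_pairSnd.bind computableMap_pairFst)).bind hΨ₂).pair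
      (computableMap_pairSnd.bind computableMap_pairSnd)).bind hΨ₁) fun p a ha hdom => ?_
  obtain ⟨c, hsub, b, hb, -⟩ := hdom
  obtain ⟨u, hu, U, hU, hUdom, hsol⟩ := H₂ p a ha ⟨b, hb⟩
  have hU' := mem_delta_opens.1 hU
  -- What the reductions do with a homogeneous `f`.
  have step : ∀ f ∈ HS {f : Ramsey | f.1 ∈ enumOpen u}, ∃ b ∈ Ψ₂ (pair p f.1), ∃ q ∈ Φ₁ b,
      ((enumOpen q)ᶜ).Nonempty ∧ ∀ x ∉ enumOpen q, ∃ r ∈ Ψ₁ (pair b x),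
        ∃ c ∈ RepresentedSpace.δ (X := C) r, c ∈ (f₀.comp g₀) a := by
    intro f hf
    obtain ⟨b, hb, y, hy, hyg⟩ := hsol f.1 f (mem_delta_ramsey.2 rfl) (by
      change f ∈ HS (U : Set Ramsey)
      rwa [hU'])
    obtain ⟨q, hq, A, hA, hAdom, hsol₁⟩ := H₁ b y hy (hsub hyg)
    have hA' := mem_delta_closeds.1 hA
    refine ⟨b, hb, q, hq, hA' ▸ hAdom, fun x hx => ?_⟩
    obtain ⟨r, hr, c, hc, hcf⟩ := hsol₁ x x (mem_delta_baire.2 rfl) (by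
      change x ∈ (A : Set Baire)
      rwa [hA'])
    exact ⟨r, hr, c, hc, hsub, y, hyg, hcf⟩
  refine ⟨pair (E p) u, ?_, _, mem_delta_baire.2 rfl, ?_, ?_⟩
  · simp only [Part.mem_bind_iff, Part.mem_map_iff, Part.mem_some_iff]
    exact ⟨_, rfl, u, hu, rfl⟩
  · obtain ⟨f, hf⟩ := hUdom
    have hf' : f ∈ HS {f : Ramsey | f.1 ∈ enumOpen u} := hU' ▸ hf
    have hne : ∀ v ∈ paramOpenRT (pair (E p) u), v ∈ sectionChoice.dom := by
      rintro v ⟨hv, hmono, hv'⟩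
      rw [pairSnd_pair] at hv'
      rw [pairFst_pair] at hv
      obtain ⟨b, hb, q, hq, ⟨x, hx⟩, -⟩ := step _ hv'
      refine ⟨pair (pairSnd v) x, by simp, ?_⟩
      rw [hv, key p _ q (by rw [pairFst_pair]; exact Part.mem_bind_iff.2 ⟨b, hb, hq⟩),
        pairSnd_pair]
      exact hx
    have hfm : pair (E p) f.1 ∈ paramOpenRT (pair (E p) u) := by
      refine ⟨by simp, ?_⟩
      simp only [pairSnd_pair]
      exact ⟨f.2, hf'⟩
    obtain ⟨y, hy⟩ := hne _ hfm
    exact ⟨y, hne, _, hfm, hy⟩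
  · rintro y' y hy ⟨-, v, ⟨hv, hmono, hv'⟩, hyv, hyr⟩
    obtain rfl := mem_delta_baire.1 hy
    rw [pairSnd_pair] at hv'
    rw [pairFst_pair] at hv
    obtain ⟨b, hb, q, hq, -, hsol'⟩ := step _ hv'
    have hb' : b ∈ Ψ₂ (pair p (pairFst y)) := by rwa [hyv]
    rw [hv, key p y q (Part.mem_bind_iff.2 ⟨b, hb', hq⟩)] at hyr
    obtain ⟨r, hr, hc⟩ := hsol' _ hyr
    refine ⟨r, ?_, hc⟩
    have hp : p ∈ Part.some (pairFst (pair p y)) := by simp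
    have hy : y ∈ Part.some (pairSnd (pair p y)) := by simp
    exact Part.mem_bind (mem_bind_map_pair (Part.mem_bind (mem_bind_map_pair hp
      (Part.mem_bind hy (Part.mem_some _))) hb') (Part.mem_bind hy (Part.mem_some _))) hr

theorem openRT_reducible_comp : WReducible openRT (sectionChoice.comp paramOpenRT) := by
  -- The open set named by `0` is empty.
  have hempty : enumOpen (fun _ => 0) = ∅ := by
    ext y
    simp only [Set.mem_empty_iff_false, iff_false]
    rintro ⟨i, σ, h, -⟩
    have : Denumerable.ofNat (Option (List ℕ)) 0 = none :=
      (Denumerable.ofNat_encode (none : Option (List ℕ)))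
    rw [this] at h
    cases h
  refine .of_forall (computableMap_zero.pair computableMap_id)
    (computableMap_pairSnd.bind computableMap_pairFst) fun p U hU hdom => ?_
  have hU' := mem_delta_opens.1 hU
  refine ⟨pair (fun _ => 0) p, by simp, _, mem_delta_baire.2 rfl, ?_, ?_⟩
  · obtain ⟨f, hf⟩ := hdom
    have hf' : f ∈ HS {f : Ramsey | f.1 ∈ enumOpen p} := hU' ▸ hf
    refine ⟨pair f.1 f.1, fun v hv => ?_, pair (fun _ => 0) f.1, ?_, ?_⟩
    · refine ⟨pair (pairSnd v) (pairSnd v), by simp, ?_⟩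
      rw [hv.1, pairFst_pair, hempty]
      exact Set.notMem_empty _
    · refine ⟨by simp, ?_⟩
      simp only [pairSnd_pair]
      exact ⟨f.2, hf'⟩
    · refine ⟨by simp, ?_⟩
      rw [pairFst_pair, hempty]
      exact Set.notMem_empty _
  · rintro y' y hy ⟨-, v, ⟨-, hmono, hv'⟩, hyv, -⟩
    obtain rfl := mem_delta_baire.1 hy
    rw [pairSnd_pair] at hv'
    refine ⟨pairSnd v, by simp [hyv], ⟨pairSnd v, hmono⟩, mem_delta_ramsey.2 rfl, ?_⟩
    change _ ∈ HS (U : Set Ramsey)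
    rw [hU']
    exact hv'

theorem comp_reducible_findHSOpen :
    WReducible (sectionChoice.comp paramOpenRT) findHSOpen := by
  obtain ⟨Φ, hΦ, hmem⟩ :=
    exists_computableMap_enumOpen (PrimrecPred.computablePred primrecRel_accepts)
  refine .of_forall hΦ computableMap_decodeSolution fun p d hd hdom => ?_
  obtain rfl := mem_delta_baire.1 hd
  obtain ⟨y, hsub, v, hv, hyv, hyr⟩ := hdom
  obtain ⟨U, hU, hU'⟩ := exists_delta_opens (Φ d)
  have hUmem : ∀ h : Ramsey, h ∈ (U : Set Ramsey) ↔ ∃ k, Accepts (pre d k) (pre h.1 k) := fun h => by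
    rw [hU']
    exact hmem d h.1
  let one : Ramsey := ⟨id, strictMono_id⟩
  refine ⟨_, Part.mem_some _, U, hU, ?_, fun b h hb hh => ?_⟩
  · obtain ⟨hv1, hmono, hv2⟩ := hv
    obtain ⟨h, hh⟩ := exists_accepted ⟨pairSnd v, hmono⟩ hv2 hyv (hv1 ▸ hyr)
    exact ⟨h, Or.inl fun g => (hUmem _).2 (hh g), (hUmem _).2 (hh one)⟩
  · obtain rfl := mem_delta_ramsey.1 hb
    obtain ⟨hhom, hhU⟩ := hh
    have hall : ∀ g : Ramsey, h.comp g ∈ (U : Set Ramsey) :=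
      hhom.resolve_right fun hno => hno one hhU
    obtain ⟨h1, hmono, h2⟩ := decodeSolution_spec fun g => (hUmem _).1 (hall g)
    refine ⟨decodeSolution h.1, by simp, _, mem_delta_baire.2 rfl, hsub,
      pair (pairFst d) (pairFst (decodeSolution h.1)), ⟨by simp, ?_⟩, by simp, by simpa using h1⟩
    simp only [pairSnd_pair]
    exact ⟨hmono, h2⟩

theorem isCompositionalProduct_comp :
    IsCompositionalProduct (sectionChoice.comp paramOpenRT) closedChoice openRT :=
  ⟨⟨Baire, Baire, Baire, inferInstance, inferInstance, inferInstance, sectionChoice, paramOpenRT,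
    sectionChoice_reducible_closedChoice, paramOpenRT_reducible_openRT, .refl _, .refl _⟩,
    fun _ _ _ _ _ _ _ _ hf hg => comp_reducible hf hg⟩

end Weihrauch

theorem mainTheorem4 :
    (∃ (X Y : Type) (_ : Weihrauch.RepresentedSpace X) (_ : Weihrauch.RepresentedSpace Y)
        (h : Weihrauch.MultiFun X Y),
        Weihrauch.IsCompositionalProduct.{u, v, w} h Weihrauch.closedChoice Weihrauch.openRT ∧
          Weihrauch.WReducible h Weihrauch.findHSOpen) ∧
      Weihrauch.WReducible Weihrauch.openRT Weihrauch.findHSOpen := by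
  exact ⟨⟨Weihrauch.Baire, Weihrauch.Baire, inferInstance, inferInstance,
    Weihrauch.sectionChoice.comp Weihrauch.paramOpenRT,
    Weihrauch.isCompositionalProduct_comp, Weihrauch.comp_reducible_findHSOpen⟩,
    Weihrauch.openRT_reducible_comp.trans Weihrauch.comp_reducible_findHSOpen⟩
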